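/- Let $I$ be a finite set with $|I|\ge 2$, and let $(I,\cdot)$ be a Cartan datum of finite type: a symmetric $\mathbb{Z}$-valued bilinear form on $\mathbb{Z}I$ with $i\cdot i\in\{2,4,6,\dots\}$ for all $i \in I$, with $2\frac{i\cdot j}{i\cdot i}\in\{0,-1,-2,\dots\}$ for $i\ne j$, and with the matrix $(i\cdot j)_{i,j\in I}$ positive definite. Let $(X,\{\alpha_i\}_{i\in I},X^\vee,\{\alpha_i^\vee\}_{i\in I})$ be a root datum of this type: $X$ and $X^\vee$ are finitely generated free abelian groups with a bilinear pairing $\langle\ ,\ \rangle\colon X^\vee\times X\to\mathbb{Z}$ that induces an isomorphism $X^\vee\to\operatorname{Hom}_{\mathbb{Z}}(X,\mathbb{Z})$, and $\alpha_i\in X$, $\alpha_i^\vee\in X^\vee$ satisfy $\langle\alpha_i^\vee,\alpha_j\rangle=2\frac{i\cdot j}{i\cdot i}=:a_{ij}$ for all $i,j \in I$. Let $W$ be the Weyl group, generated by the reflections $x\mapsto x-\langle\alpha_i^\vee,x\rangle\alpha_i$ of $X$. Let $X^+=\{\lambda\in X:\langle\alpha_i^\vee,\lambda\rangle\ge 0\text{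 for all }i \in I\}$. A set $\pi\subseteq X^+$ is saturated if $\mu\in\pi$, $\mu'\in X^+$ and $\mu-\mu'\in\sum_i\mathbb{Z}_{\ge0}\alpha_i$ imply $\mu'\in\pi$. Over $\mathbb{Q}(v)$ put $v_i=v^{(i\cdot i)/2}$, and for $a\in\mathbb{Z}$, $t\ge0$ put $$\left[{a\atop t}\right]_i=\prod_{s=1}^t\frac{v_i^{a-s+1}-v_i^{-a+s-1}}{v_i^s-v_i^{-s}},\qquad [a]_i=\left[{a\atop 1}\right]_i .$$ For a finite saturated set $\pi\subset X^+$ let $\mathbf{S}(\pi)$ be the associative unital $\mathbb{Q}(v)$-algebra with generators $E_i,F_i$ ($i\in I$) and $1_\lambda$ ($\lambda\in W\pi$) and relations, for all $\lambda,\mu\in W\pi$ and $i,j\in I$, (a) $1_\lambda1_\mu=\delta_{\lambda\mu}1_\lambda$, $\ \sum_{\lambda\in W\pi}1_\lambda=1$; (b) $E_iF_j-F_jE_i=\delta_{ij}\sum_{\lambda\in W\pi}[\langle\alpha_i^\vee,\lambda\rangle]_i\,1_\lambda$; (c) $E_i1_\lambda=1_{\lambda+\alpha_i}E_i$, $\ 1_\lambda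 E_i=E_i1_{\lambda-\alpha_i}$, $\ F_i1_\lambda=1_{\lambda-\alpha_i}F_i$, $\ 1_\lambda F_i=F_i1_{\lambda+\alpha_i}$, where $1_{\lambda\pm\alpha_i}$ means $0$ if $\lambda\pm\alpha_i\notin W\pi$. Then for every finite saturated set $\pi\subset X^+$ and all $i\ne j$ in $I$ the quantum Serre relations $$\sum_{s=0}^{1-a_{ij}}(-1)^s\left[{1-a_{ij}\atop s}\right]_iE_i^{1-a_{ij}-s}E_jE_i^s=0,\qquad \sum_{s=0}^{1-a_{ij}}(-1)^s\left[{1-a_{ij}\atop s}\right]_iF_i^{1-a_{ij}-s}F_jF_i^s=0$$ hold in $\mathbf{S}(\pi)$. -/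

import Mathlib

namespace QSchur

open Matrix

/-- A Cartan datum `(I, ·)` of finite type: the integer-valued symmetric bilinear form on the free
abelian group on `I` is given by its Gram matrix `form i j = i · j`. -/
structure CartanDatum (I : Type*) [Fintype I] where
  form : Matrix I I ℤ
  symm : form.IsSymm
  pos_diag : ∀ i, 0 < form i i
  even_diag : ∀ i, Even (form i i)
  off_diag : ∀ i j, i ≠ j → ∃ n : ℕ, 2 * form i j = -(n : ℤ) * form i i
  finite_type : (form.map (Int.cast : ℤ → ℝ)).PosDef

/-- A root datum of type `(I, ·)`, with weight lattice `X` and coweight lattice `Y` (the dual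
lattice of `X` through the perfect pairing). -/
structure RootDatum {I : Type*} [Fintype I] (C : CartanDatum I) (X Y : Type*)
    [AddCommGroup X] [Module.Free ℤ X] [Module.Finite ℤ X]
    [AddCommGroup Y] [Module.Free ℤ Y] [Module.Finite ℤ Y] where
  pairing : Y →ₗ[ℤ] X →ₗ[ℤ] ℤ
  perfect : Function.Bijective pairing
  root : I → X
  coroot : I → Y
  pairing_coroot_root : ∀ i j, pairing (coroot i) (root j) * C.form i i = 2 * C.form i j

/-- The symmetrizing integers `d_i = (i · i) / 2` (an exact division). -/
def CartanDatum.d {I : Type*} [Fintype I] (C : CartanDatum I) (i : I) : ℤ := C.form i i / 2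

/-- `v_i = v ^ d_i` in the field `ℚ(v)`. -/
noncomputable def CartanDatum.v {I : Type*} [Fintype I] (C : CartanDatum I) (i : I) : RatFunc ℚ :=
  (RatFunc.X : RatFunc ℚ) ^ C.d i

/-- The Gaussian binomial coefficient `[a choose t]`, with `u` in place of `v`. -/
noncomputable def qBinom (u : RatFunc ℚ) (a : ℤ) (t : ℕ) : RatFunc ℚ :=
  ∏ s ∈ Finset.Icc 1 t,
    (u ^ (a - (s : ℤ) + 1) - u ^ (-a + (s : ℤ) - 1)) / (u ^ (s : ℤ) - u ^ (-(s : ℤ)))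

/-- The quantum integer `[n]`, with `u` in place of `v`. -/
noncomputable def qInt (u : RatFunc ℚ) (n : ℤ) : RatFunc ℚ :=
  (u ^ n - u ^ (-n)) / (u - u⁻¹)

namespace RootDatum

variable {I : Type*} [Fintype I] {C : CartanDatum I} {X Y : Type*}
  [AddCommGroup X] [Module.Free ℤ X] [Module.Finite ℤ X]
  [AddCommGroup Y] [Module.Free ℤ Y] [Module.Finite ℤ Y]

/-- The Cartan integers `a_ij = ⟨α_i^∨, α_j⟩`. -/
def a (D : RootDatum C X Y) (i j : I) : ℤ := D.pairing (D.coroot i) (D.root j)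

theorem pairing_self (D : RootDatum C X Y) (i : I) :
    D.pairing (D.coroot i) (D.root i) = 2 :=
  mul_right_cancel₀ (C.pos_diag i).ne' (D.pairing_coroot_root i i)

/-- The simple reflection `s_i : x ↦ x - ⟨α_i^∨, x⟩ α_i` of `X`. -/
def simpleReflection (D : RootDatum C X Y) (i : I) : X ≃ₗ[ℤ] X :=
  Module.reflection (D.pairing_self i)

/-- The Weyl group, as a group of automorphisms of `X`. -/
def weylGroup (D : RootDatum C X Y) : Subgroup (X ≃ₗ[ℤ] X) :=
  Subgroup.closure (Set.range D.simpleReflection)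

/-- The set `X⁺` of dominant weights. -/
def dominant (D : RootDatum C X Y) : Set X :=
  {x | ∀ i, 0 ≤ D.pairing (D.coroot i) x}

/-- The dominance order: `D.Dominates x y` means that `x - y` is a sum of simple roots with
nonnegative integer coefficients. -/
def Dominates (D : RootDatum C X Y) (x y : X) : Prop :=
  ∃ n : I → ℕ, x - y = ∑ i, n i • D.root i

/-- A saturated set of dominant weights. -/
def IsSaturated (D : RootDatum C X Y) (S : Set X) : Prop :=
  S ⊆ D.dominant ∧ ∀ x ∈ S, ∀ y ∈ D.dominant, D.Dominates x y → y ∈ S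

/-- The set `Wπ` of all Weyl group conjugates of elements of `π`. -/
def weights (D : RootDatum C X Y) (S : Finset X) : Set X :=
  {x | ∃ w ∈ D.weylGroup, ∃ y ∈ S, x = w y}

theorem finite_bounded {A : Matrix I I ℝ} (hA : A.PosDef) (p : I → ℝ) (c : ℝ) :
    {n : I → ℤ | (fun k => p k + n k) ⬝ᵥ A *ᵥ (fun k => p k + n k) = c}.Finite := by
  classical
  have hpsd : ∀ x : I → ℝ, 0 ≤ x ⬝ᵥ A *ᵥ x := fun x => by
    simpa using hA.posSemidef.dotProduct_mulVec_nonneg x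
  have hsym : ∀ x y : I → ℝ, x ⬝ᵥ A *ᵥ y = y ⬝ᵥ A *ᵥ x := fun x y => by
    have h : Aᵀ = A := by simpa [Matrix.IsHermitian] using hA.1
    rw [dotProduct_mulVec, ← mulVec_transpose, h, dotProduct_comm]
  have hex : ∀ k : I, ∃ e : I → ℝ, A *ᵥ e = Pi.single k 1 := fun k =>
    (Matrix.mulVec_surjective_iff_isUnit.2 hA.isUnit) _
  choose e he using hex
  have key : ∀ (x : I → ℝ) (k : I), |x k| ≤ (x ⬝ᵥ A *ᵥ x + e k k) / 2 := by
    intro x k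
    have h1 := hpsd (x - e k)
    have h2 := hpsd (x + e k)
    have h3 : x ⬝ᵥ A *ᵥ e k = x k := by rw [he]; simp
    have h4 : e k ⬝ᵥ A *ᵥ x = x k := by rw [hsym, h3]
    have h5 : e k ⬝ᵥ A *ᵥ e k = e k k := by rw [he]; simp
    simp only [mulVec_sub, mulVec_add, sub_dotProduct, add_dotProduct, dotProduct_sub,
      dotProduct_add, h3, h4, h5] at h1 h2
    rw [abs_le]
    constructor <;> linarith
  refine Set.Finite.subset (Set.Finite.pi' (t := fun k : I =>
    Set.Icc ⌈-((c + e k k) / 2) - p k⌉ ⌊(c + e k k) / 2 - p k⌋) fun k => Set.finite_Icc _ _) ?_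
  intro n hn k
  have h := key (fun k => p k + n k) k
  have hn' : (fun k => p k + (n k : ℝ)) ⬝ᵥ A *ᵥ (fun k => p k + (n k : ℝ)) = c := hn
  rw [hn', abs_le] at h
  simp only [Set.mem_Icc, Int.ceil_le, Int.le_floor]
  constructor <;> linarith

theorem quad_reflection [DecidableEq I] {A : Matrix I I ℝ} (hA : A.PosDef) (x : I → ℝ) (i : I)
    (m : ℝ) (hm : (A *ᵥ x) i = A i i / 2 * m) :
    (x - m • Pi.single i 1) ⬝ᵥ A *ᵥ (x - m • Pi.single i 1) = x ⬝ᵥ A *ᵥ x := by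
  have h : Aᵀ = A := by simpa [Matrix.IsHermitian] using hA.1
  have h1 : (Pi.single i (1 : ℝ)) ⬝ᵥ A *ᵥ x = A i i / 2 * m := by rw [← hm]; simp
  have h2 : x ⬝ᵥ A *ᵥ (Pi.single i (1 : ℝ)) = A i i / 2 * m := by
    rw [← h1, dotProduct_mulVec, ← mulVec_transpose, h, dotProduct_comm]
  have h3 : (Pi.single i (1 : ℝ)) ⬝ᵥ A *ᵥ (Pi.single i (1 : ℝ)) = A i i := by simp
  rw [mulVec_sub, sub_dotProduct, dotProduct_sub, dotProduct_sub, mulVec_smul, smul_dotProduct,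
    smul_dotProduct, dotProduct_smul, dotProduct_smul, h1, h2, h3]
  simp only [smul_eq_mul]
  ring

/-- `Wπ` is finite, so that the sums over `Wπ` below are finite sums. -/
theorem finite_weights (D : RootDatum C X Y) (S : Finset X) : (D.weights S).Finite := by
  classical
  have horb : ∀ y : X, {x | ∃ w ∈ D.weylGroup, x = w y}.Finite := by
    intro y
    set A : Matrix I I ℝ := C.form.map (Int.cast : ℤ → ℝ) with hAdef
    have hA : A.PosDef := C.finite_type
    obtain ⟨p, hp⟩ := (Matrix.mulVec_surjective_iff_isUnit.2 hA.isUnit)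
      (fun i => (C.form i i : ℝ) / 2 * (D.pairing (D.coroot i) y : ℝ))
    let Q : (I → ℤ) → ℝ := fun n => (fun k => p k + n k) ⬝ᵥ A *ᵥ (fun k => p k + n k)
    let T : Set X := {x | ∃ n : I → ℤ, x = y + ∑ k, n k • D.root k ∧ Q n = Q 0}
    have hT : T.Finite := by
      refine ((finite_bounded hA p (Q 0)).image (fun n => y + ∑ k, n k • D.root k)).subset ?_
      rintro x ⟨n, rfl, hn⟩
      exact ⟨n, hn, rfl⟩
    have hs : ∀ i, ∀ x ∈ T, D.simpleReflection i x ∈ T := by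
      rintro i _ ⟨n, rfl, hn⟩
      set x := y + ∑ k, n k • D.root k with hx
      set m := D.pairing (D.coroot i) x with hm
      have hmA : (A *ᵥ (fun k => p k + n k)) i = (C.form i i : ℝ) / 2 * m := by
        have h1 : (A *ᵥ (fun k => p k + (n k : ℝ))) i
            = (A *ᵥ p) i + ∑ k, (C.form i k : ℝ) * n k := by
          simp [mulVec, dotProduct, mul_add, Finset.sum_add_distrib, hAdef]
        have h2 : (m : ℝ) = D.pairing (D.coroot i) y
            + ∑ k, (n k : ℝ) * (D.pairing (D.coroot i) (D.root k) : ℝ) := by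
          rw [hm, hx]
          simp [map_add, map_sum]
        rw [h1, hp, h2, mul_add, Finset.mul_sum]
        congr 1
        refine Finset.sum_congr rfl fun k _ => ?_
        have h3 : (D.pairing (D.coroot i) (D.root k) : ℝ) * C.form i i = 2 * C.form i k := by
          exact_mod_cast D.pairing_coroot_root i k
        linear_combination (-(n k : ℝ) / 2) * h3
      refine ⟨n - Pi.single i m, ?_, ?_⟩
      · rw [simpleReflection, Module.reflection_apply, ← hm, hx]
        simp only [Pi.sub_apply, sub_smul, Finset.sum_sub_distrib]
        rw [Finset.sum_eq_single (f := fun k => (Pi.single i m : I → ℤ) k • D.root k) i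
          (fun b _ hb => by simp [hb]) (by simp)]
        simp [add_sub_assoc]
      · rw [← hn]
        have hf : (fun k => p k + ((n - Pi.single i m : I → ℤ) k : ℝ))
            = (fun k => p k + (n k : ℝ)) - (m : ℝ) • Pi.single i 1 := by
          funext k
          by_cases hk : k = i
          · subst hk; simp; ring
          · simp [hk]
        have hq := quad_reflection hA (fun k => p k + (n k : ℝ)) i m hmA
        rw [← hf] at hq
        exact hq
    have hW : ∀ w ∈ D.weylGroup, ∀ x, w x ∈ T ↔ x ∈ T := by
      intro w hw
      refine Subgroup.closure_induction (p := fun w _ => ∀ x, w x ∈ T ↔ x ∈ T)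
        ?_ ?_ ?_ ?_ hw
      · rintro _ ⟨i, rfl⟩ x
        refine ⟨fun h => ?_, hs i x⟩
        have h' := hs i _ h
        rwa [simpleReflection, Module.involutive_reflection] at h'
      · intro x; rfl
      · intro u v _ _ hu hv x
        exact (hu (v x)).trans (hv x)
      · intro u _ hu x
        rw [← hu]
        change (u * u⁻¹) x ∈ T ↔ _
        rw [mul_inv_cancel]
        rfl
    refine hT.subset ?_
    rintro _ ⟨w, hw, rfl⟩
    exact (hW w hw y).2 ⟨0, by simp, rfl⟩
  refine (S.finite_toSet.biUnion fun y _ => horb y).subset ?_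
  rintro x ⟨w, hw, y, hy, rfl⟩
  exact Set.mem_biUnion (Finset.mem_coe.2 hy) ⟨w, hw, rfl⟩

/-- The generators `E_i`, `F_i` (for `i ∈ I`) and `1_x` (for `x ∈ Wπ`). -/
inductive Gen (D : RootDatum C X Y) (S : Finset X)
  | E : I → Gen D S
  | F : I → Gen D S
  | idem : D.weights S → Gen D S

/-- The free associative `ℚ(v)`-algebra with `1` on the generators. -/
abbrev Free (D : RootDatum C X Y) (S : Finset X) : Type _ := FreeAlgebra (RatFunc ℚ) (Gen D S)

/-- The generator `E_i` of the free algebra. -/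
noncomputable def freeE (D : RootDatum C X Y) (S : Finset X) (i : I) : Free D S := FreeAlgebra.ι _ (.E i)

/-- The generator `F_i` of the free algebra. -/
noncomputable def freeF (D : RootDatum C X Y) (S : Finset X) (i : I) : Free D S := FreeAlgebra.ι _ (.F i)

open Classical in
/-- The symbol `1_x` for any `x ∈ X`: the generator if `x ∈ Wπ`, and `0` otherwise. -/
noncomputable def freeIdem (D : RootDatum C X Y) (S : Finset X) (x : X) : Free D S :=
  if h : x ∈ D.weights S then FreeAlgebra.ι _ (.idem ⟨x, h⟩) else 0

/-- The defining relations of the generalized `q`-Schur algebra. -/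
inductive Rel (D : RootDatum C X Y) (S : Finset X) : Free D S → Free D S → Prop
  | idem_mul_self (x : X) (hx : x ∈ D.weights S) :
      Rel D S (D.freeIdem S x * D.freeIdem S x) (D.freeIdem S x)
  | idem_mul_of_ne (x y : X) (hx : x ∈ D.weights S) (hy : y ∈ D.weights S) (hxy : x ≠ y) :
      Rel D S (D.freeIdem S x * D.freeIdem S y) 0
  | sum_idem : Rel D S (∑ᶠ x : D.weights S, D.freeIdem S (x : X)) 1
  | EF_self (i : I) :
      Rel D S (D.freeE S i * D.freeF S i - D.freeF S i * D.freeE S i)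
        (∑ᶠ x : D.weights S,
          qInt (C.v i) (D.pairing (D.coroot i) (x : X)) • D.freeIdem S (x : X))
  | EF_of_ne (i j : I) (hij : i ≠ j) :
      Rel D S (D.freeE S i * D.freeF S j - D.freeF S j * D.freeE S i) 0
  | E_idem (i : I) (x : X) (hx : x ∈ D.weights S) :
      Rel D S (D.freeE S i * D.freeIdem S x) (D.freeIdem S (x + D.root i) * D.freeE S i)
  | idem_E (i : I) (x : X) (hx : x ∈ D.weights S) :
      Rel D S (D.freeIdem S x * D.freeE S i) (D.freeE S i * D.freeIdem S (x - D.root i))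
  | F_idem (i : I) (x : X) (hx : x ∈ D.weights S) :
      Rel D S (D.freeF S i * D.freeIdem S x) (D.freeIdem S (x - D.root i) * D.freeF S i)
  | idem_F (i : I) (x : X) (hx : x ∈ D.weights S) :
      Rel D S (D.freeIdem S x * D.freeF S i) (D.freeF S i * D.freeIdem S (x + D.root i))

/-- The generalized `q`-Schur algebra over `ℚ(v)`, given by generators and relations. -/
abbrev SchurAlg (D : RootDatum C X Y) (S : Finset X) : Type _ := RingQuot (Rel D S)

/-- The generator `E_i` of the generalized `q`-Schur algebra. -/
noncomputable def E (D : RootDatum C X Y) (S : Finset X) (i : I) : SchurAlg D S :=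
  RingQuot.mkAlgHom (RatFunc ℚ) (Rel D S) (D.freeE S i)

/-- The generator `F_i` of the generalized `q`-Schur algebra. -/
noncomputable def F (D : RootDatum C X Y) (S : Finset X) (i : I) : SchurAlg D S :=
  RingQuot.mkAlgHom (RatFunc ℚ) (Rel D S) (D.freeF S i)

end RootDatum

end QSchur

/-! Fix `i ≠ j` and put `q = v_i`, `e = E_i`, `f = F_i`, `y = E_j`, `n = -a_ij`. The element `K = ∑
q^⟨α_i^∨, x⟩ 1_x` is invertible, and with `L = K⁻¹` the relations (a)–(c) make `e, f, K` a quantum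
`sl₂`-triple. Since `f` commutes with `y`, `y` is a lowest weight vector of weight `-n` for the
quantum adjoint action; let `x_m` be its image under the `m`-th power of the action of `e`.

Finiteness of `Wπ` makes `e` nilpotent (`isNilpotent_of_shift`), and `x_m` is a combination of the
`e^(m-s) y e^s` (`qAd_eq_sum`), so `x_m = 0` for large `m`. The commutator of `f` with `x_m` is
`-[m][-n+m-1] x_{m-1} L` (`commutator_qAd`), and this scalar is nonzero for `m > n + 1`, as `q` is
not a root of unity. Hence vanishing descends to `x_{n+1}` (`qAd_eq_zero`), whose expansion is
exactly the Serre sum. The relation for the `F`'s follows by exchanging `e` with `f` and `K` with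
`L`. -/

namespace QSchur

/-! ### The quantum adjoint action on a lowest weight vector. -/

section QuantumCommutators

variable {k A : Type*} [Field k] [Ring A] [Algebra k A]

/-- The iterated quantum commutators `x₀ = y`, `x_{m+1} = e x_m - q^(a+2m) x_m e`, that is, the
images of a vector `y` of weight `a` under the powers of the quantum adjoint action of `e`. -/
def qAd (q : k) (a : ℤ) (e y : A) : ℕ → A
  | 0 => y
  | m + 1 => e * qAd q a e y m - q ^ (a + 2 * (m : ℤ)) • (qAd q a e y m * e)

theorem mul_qAd {q : k} (hq : q ≠ 0) {a : ℤ} {e y K : A} (hKe : K * e = q ^ (2 : ℤ) • (e * K))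
    (hKy : K * y = q ^ a • (y * K)) (m : ℕ) :
    K * qAd q a e y m = q ^ (a + 2 * (m : ℤ)) • (qAd q a e y m * K) := by
  induction m with
  | zero => simpa [qAd] using hKy
  | succ m ih =>
    have h1 : K * (e * qAd q a e y m)
        = (q ^ (2 : ℤ) * q ^ (a + 2 * (m : ℤ))) • (e * qAd q a e y m * K) := by
      rw [← mul_assoc, hKe, smul_mul_assoc, mul_assoc, ih, mul_smul_comm, smul_smul, mul_assoc]
    have h2 : K * (qAd q a e y m * e)
        = (q ^ (2 : ℤ) * q ^ (a + 2 * (m : ℤ))) • (qAd q a e y m * e * K) := by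
      rw [← mul_assoc, ih, smul_mul_assoc, mul_assoc, hKe, mul_smul_comm, smul_smul, mul_assoc,
        mul_comm (q ^ (2 : ℤ))]
    have h3 : q ^ (a + 2 * ((m + 1 : ℕ) : ℤ)) = q ^ (2 : ℤ) * q ^ (a + 2 * (m : ℤ)) := by
      rw [← zpow_add₀ hq]; congr 1; push_cast; ring
    rw [h3, qAd, mul_sub, mul_smul_comm, h1, h2, sub_mul, smul_sub, smul_mul_assoc, smul_comm]

theorem mul_inv_qAd {q : k} (hq : q ≠ 0) {a : ℤ} {e y K L : A} (hKL : K * L = 1) (hLK : L * K = 1)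
    (hKe : K * e = q ^ (2 : ℤ) • (e * K)) (hKy : K * y = q ^ a • (y * K)) (m : ℕ) :
    L * qAd q a e y m = q ^ (-(a + 2 * (m : ℤ))) • (qAd q a e y m * L) := by
  have h := congrArg (fun z => L * z * L) (mul_qAd hq hKe hKy m)
  simp only [mul_smul_comm, smul_mul_assoc] at h
  rw [← mul_assoc, hLK, one_mul, mul_assoc L, mul_assoc _ K, hKL, mul_one] at h
  rw [h, smul_smul, ← zpow_add₀ hq]
  simp

/-- The scalar `-[m][a+m-1]` by which the lowering operator sends `x_m` to `x_{m-1}`. -/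
def qAdCoeff (q : k) (a : ℤ) (m : ℕ) : k :=
  -((q ^ (m : ℤ) - q ^ (-(m : ℤ))) / (q - q⁻¹)
    * ((q ^ (a + m - 1) - q ^ (-(a + m - 1))) / (q - q⁻¹)))

/-- This is `[m+1][a+m] = [m][a+m-1] + [a+2m]`, the recursion produced by the induction in
`commutator_qAd`. -/
theorem qAdCoeff_succ {q : k} (hq : q ≠ 0) (a : ℤ) (m : ℕ) :
    qAdCoeff q a (m + 1) = qAdCoeff q a m
      - (q ^ (a + 2 * (m : ℤ)) - q ^ (-(a + 2 * (m : ℤ)))) / (q - q⁻¹) := by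
  have key : (q ^ ((m : ℤ) + 1) - q ^ (-((m : ℤ) + 1))) * (q ^ (a + m) - q ^ (-(a + m)))
      = (q ^ (m : ℤ) - q ^ (-(m : ℤ))) * (q ^ (a + m - 1) - q ^ (-(a + m - 1)))
        + (q ^ (a + 2 * (m : ℤ)) - q ^ (-(a + 2 * (m : ℤ)))) * (q - q⁻¹) := by
    have h1 : q - q⁻¹ = q ^ (1 : ℤ) - q ^ (-1 : ℤ) := by simp
    have e : ∀ {x y : ℤ}, x = y → q ^ x = q ^ y := fun h => by rw [h]
    calc _ = (q ^ (a + 2 * (m : ℤ) + 1) + q ^ (-(a + 2 * (m : ℤ) + 1))) - q ^ (1 - a)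
              - q ^ (a - 1) := by
            simp only [sub_mul, mul_sub, ← zpow_add₀ hq]
            rw [e (show (m : ℤ) + 1 + (a + m) = a + 2 * m + 1 by ring),
              e (show (m : ℤ) + 1 + -(a + m) = 1 - a by ring),
              e (show -((m : ℤ) + 1) + (a + m) = a - 1 by ring),
              e (show -((m : ℤ) + 1) + -(a + m) = -(a + 2 * m + 1) by ring)]
            ring
      _ = _ := by
            rw [h1]
            simp only [sub_mul, mul_sub, ← zpow_add₀ hq]
            rw [e (show (m : ℤ) + (a + m - 1) = a + 2 * m - 1 by ring),
              e (show (m : ℤ) + -(a + m - 1) = 1 - a by ring),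
              e (show -(m : ℤ) + (a + m - 1) = a - 1 by ring),
              e (show -(m : ℤ) + -(a + m - 1) = -(a + 2 * m - 1) by ring),
              e (show a + 2 * (m : ℤ) + -1 = a + 2 * m - 1 by ring),
              e (show -(a + 2 * (m : ℤ)) + 1 = -(a + 2 * m - 1) by ring),
              e (show -(a + 2 * (m : ℤ)) + -1 = -(a + 2 * m + 1) by ring)]
            ring
  have h4 : a + ((m + 1 : ℕ) : ℤ) - 1 = a + m := by push_cast; ring
  rw [qAdCoeff, qAdCoeff, h4]
  push_cast
  rw [div_mul_div_comm, div_mul_div_comm, key]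
  field_simp
  ring

theorem zpow_sub_zpow_neg_ne_zero {q : k} (hq : q ≠ 0) (hroot : ∀ n : ℤ, n ≠ 0 → q ^ n ≠ 1)
    {n : ℤ} (hn : n ≠ 0) : q ^ n - q ^ (-n) ≠ 0 := by
  intro h
  apply hroot (n + n) (by omega)
  rw [zpow_add₀ hq]
  nth_rewrite 1 [sub_eq_zero.1 h]
  rw [← zpow_add₀ hq]
  simp

theorem qAdCoeff_ne_zero {q : k} (hq : q ≠ 0) (hroot : ∀ n : ℤ, n ≠ 0 → q ^ n ≠ 1) {a : ℤ} {m : ℕ}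
    (hm : m ≠ 0) (ham : a + m - 1 ≠ 0) : qAdCoeff q a m ≠ 0 := by
  have h1 : q - q⁻¹ ≠ 0 := by simpa using zpow_sub_zpow_neg_ne_zero hq hroot one_ne_zero
  exact neg_ne_zero.2 (mul_ne_zero
    (div_ne_zero (zpow_sub_zpow_neg_ne_zero hq hroot (by exact_mod_cast hm)) h1)
    (div_ne_zero (zpow_sub_zpow_neg_ne_zero hq hroot ham) h1))

/-- A lowering operator `f` commuting with `y` maps `x_{m+1}` to a multiple of `x_m`. -/
theorem commutator_qAd {q : k} (hq : q ≠ 0) {a : ℤ} {e f y K L : A}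
    (hKL : K * L = 1) (hLK : L * K = 1)
    (hKe : K * e = q ^ (2 : ℤ) • (e * K)) (hKy : K * y = q ^ a • (y * K))
    (hef : e * f - f * e = (q - q⁻¹)⁻¹ • (K - L)) (hfy : f * y = y * f) (m : ℕ) :
    f * qAd q a e y (m + 1) - qAd q a e y (m + 1) * f
      = qAdCoeff q a (m + 1) • (qAd q a e y m * L) := by
  -- Moving `f` past the two outer factors `e` creates terms in `x_m K` and `x_m L`; the twist
  -- `q^(a+2m)` is the weight of `x_m`, so the `K` terms cancel.
  have step : ∀ m : ℕ, f * qAd q a e y (m + 1) - qAd q a e y (m + 1) * f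
      = e * (f * qAd q a e y m - qAd q a e y m * f)
        - q ^ (a + 2 * (m : ℤ)) • ((f * qAd q a e y m - qAd q a e y m * f) * e)
        - ((q ^ (a + 2 * (m : ℤ)) - q ^ (-(a + 2 * (m : ℤ)))) / (q - q⁻¹))
          • (qAd q a e y m * L) := by
    intro m
    have hK := mul_qAd hq hKe hKy m
    have hL := mul_inv_qAd hq hKL hLK hKe hKy m
    rw [qAd]
    set x := qAd q a e y m
    set b := q ^ (a + 2 * (m : ℤ))
    set b' := q ^ (-(a + 2 * (m : ℤ)))
    have hfe : f * e = e * f - (q - q⁻¹)⁻¹ • (K - L) := by rw [← hef]; abel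
    have h1 : f * (e * x) = e * (f * x) - (q - q⁻¹)⁻¹ • (b • (x * K) - b' • (x * L)) := by
      rw [← mul_assoc, hfe, sub_mul, smul_mul_assoc, sub_mul, hK, hL, mul_assoc]
    have h2 : x * e * f = x * f * e + (q - q⁻¹)⁻¹ • (x * K - x * L) := by
      rw [mul_assoc, mul_assoc, hfe, mul_sub, mul_smul_comm, mul_sub]; abel
    rw [mul_sub, sub_mul, mul_smul_comm, smul_mul_assoc, h1, h2, ← mul_assoc f x e]
    simp only [mul_sub, sub_mul, mul_assoc]
    module
  have hLe : L * e = q ^ (-2 : ℤ) • (e * L) := by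
    have h := congrArg (fun z => L * z * L) hKe
    simp only [mul_smul_comm, smul_mul_assoc] at h
    rw [← mul_assoc, hLK, one_mul, mul_assoc L, mul_assoc _ K, hKL, mul_one] at h
    rw [h, smul_smul, ← zpow_add₀ hq]
    simp
  induction m with
  | zero =>
    rw [step, qAdCoeff_succ hq]
    simp only [qAd, hfy, qAdCoeff]
    simp
  | succ m ih =>
    -- Moving `L` past `e` lowers the twist from weight `a+2(m+1)` to `a+2m`, which is the one that
    -- builds `x_{m+1}` from `x_m`.
    have hb : q ^ (a + 2 * ((m + 1 : ℕ) : ℤ)) * q ^ (-2 : ℤ) = q ^ (a + 2 * (m : ℤ)) := by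
      rw [← zpow_add₀ hq]; congr 1; push_cast; ring
    rw [step, ih, qAdCoeff_succ hq a (m + 1), sub_smul]
    congr 1
    rw [mul_smul_comm, smul_mul_assoc, smul_comm, ← smul_sub, mul_assoc, hLe, mul_smul_comm,
      smul_smul, hb, ← mul_assoc, ← mul_assoc, ← smul_mul_assoc, ← sub_mul, ← qAd]

/-- In a locally finite situation, the lowest weight vector `y` of weight `-n` is killed by the
`(n+1)`-st power of the adjoint action. -/
theorem qAd_eq_zero {q : k} (hq : q ≠ 0) (hroot : ∀ n : ℤ, n ≠ 0 → q ^ n ≠ 1) {n : ℕ}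
    {e f y K L : A} (hKL : K * L = 1) (hLK : L * K = 1)
    (hKe : K * e = q ^ (2 : ℤ) • (e * K)) (hKy : K * y = q ^ (-(n : ℤ)) • (y * K))
    (hef : e * f - f * e = (q - q⁻¹)⁻¹ • (K - L)) (hfy : f * y = y * f) {M : ℕ}
    (hM : ∀ m, M ≤ m → qAd q (-(n : ℤ)) e y m = 0) :
    qAd q (-(n : ℤ)) e y (n + 1) = 0 := by
  have desc : ∀ d, qAd q (-(n : ℤ)) e y (n + 1 + d) = 0 → qAd q (-(n : ℤ)) e y (n + 1) = 0 := by
    intro d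
    induction d with
    | zero => exact id
    | succ d ih =>
      intro h
      apply ih
      have hc := commutator_qAd hq hKL hLK hKe hKy hef hfy (n + 1 + d)
      rw [show n + 1 + d + 1 = n + 1 + (d + 1) by ring, h, mul_zero, zero_mul, sub_zero] at hc
      -- The second factor of the scalar is `[d+1]`; it would be `[0]` one step lower, so the
      -- descent stops at `n + 1`.
      have h0 := (smul_eq_zero.1 hc.symm).resolve_left
        (qAdCoeff_ne_zero hq hroot (by omega) (by push_cast; omega))
      have h1 := congrArg (· * K) h0
      simpa [mul_assoc, hLK] using h1
  exact desc M (hM _ (by omega))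

end QuantumCommutators

/-! ### Quantum integers and Gaussian binomials. -/

theorem qInt_smul {A : Type*} [Ring A] [Algebra (RatFunc ℚ) A] (u : RatFunc ℚ) (n : ℤ) (z : A) :
    qInt u n • z = (u - u⁻¹)⁻¹ • (u ^ n • z - u ^ (-n) • z) := by
  rw [← sub_smul, smul_smul, qInt, div_eq_inv_mul]

theorem qBinom_zero (u : RatFunc ℚ) (a : ℤ) : qBinom u a 0 = 1 := by simp [qBinom]

theorem qBinom_succ (u : RatFunc ℚ) (a : ℤ) (t : ℕ) :
    qBinom u a (t + 1) = qBinom u a t * ((u ^ (a - t) - u ^ (-a + t)) /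
      (u ^ ((t : ℤ) + 1) - u ^ (-((t : ℤ) + 1)))) := by
  rw [qBinom, qBinom, Finset.prod_Icc_succ_top (by omega)]
  push_cast
  rw [show a - ((t : ℤ) + 1) + 1 = a - t by ring, show -a + ((t : ℤ) + 1) - 1 = -a + t by ring]

theorem qBinom_add_one_succ (u : RatFunc ℚ) (a : ℤ) (t : ℕ) :
    qBinom u (a + 1) (t + 1) = qBinom u a t * ((u ^ (a + 1) - u ^ (-(a + 1))) /
      (u ^ ((t : ℤ) + 1) - u ^ (-((t : ℤ) + 1)))) := by
  induction t with
  | zero =>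
    simp only [zero_add, qBinom_succ, qBinom_zero, neg_add]
    simp
  | succ t ih =>
    rw [qBinom_succ, ih, qBinom_succ]
    push_cast
    rw [show a + 1 - ((t : ℤ) + 1) = a - t by ring, show -(a + 1) + ((t : ℤ) + 1) = -a + t by ring]
    ring

theorem qBinom_pascal {u : RatFunc ℚ} (hu : u ≠ 0) (hroot : ∀ n : ℤ, n ≠ 0 → u ^ n ≠ 1) (a : ℤ)
    (t : ℕ) : qBinom u (a + 1) (t + 1)
      = u ^ (-((t : ℤ) + 1)) * qBinom u a (t + 1) + u ^ (a - t) * qBinom u a t := by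
  have h := zpow_sub_zpow_neg_ne_zero hu hroot (n := (t : ℤ) + 1) (by omega)
  rw [qBinom_add_one_succ, qBinom_succ]
  have key : u ^ (a + 1) - u ^ (-(a + 1))
      = u ^ (-((t : ℤ) + 1)) * (u ^ (a - t) - u ^ (-a + t))
        + u ^ (a - t) * (u ^ ((t : ℤ) + 1) - u ^ (-((t : ℤ) + 1))) := by
    simp only [mul_sub, ← zpow_add₀ hu]
    rw [show a - (t : ℤ) + ((t : ℤ) + 1) = a + 1 by ring,
      show -((t : ℤ) + 1) + (-a + t) = -(a + 1) by ring,
      add_comm (-((t : ℤ) + 1)) (a - t)]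
    ring
  rw [key]
  field_simp

theorem qBinom_natCast_self_succ (u : RatFunc ℚ) (m : ℕ) : qBinom u m (m + 1) = 0 := by
  rw [qBinom_succ]; simp

/-! ### Expansion of the iterated commutators, and the abstract Serre relation. -/

section Expansion

variable {A : Type*} [Ring A] [Algebra (RatFunc ℚ) A]

/-- Left and right multiplication by `e` commute, so this is a `q`-binomial expansion, proved from
the `q`-Pascal rule. -/
theorem qAd_eq_sum {q : RatFunc ℚ} (hq : q ≠ 0) (hroot : ∀ n : ℤ, n ≠ 0 → q ^ n ≠ 1) (a : ℤ)
    (e y : A) (m : ℕ) :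
    qAd q a e y m = ∑ s ∈ Finset.range (m + 1),
      ((-1) ^ s * q ^ ((s : ℤ) * (a + m - 1)) * qBinom q m s) • (e ^ (m - s) * y * e ^ s) := by
  induction m with
  | zero => simp [qAd, qBinom_zero]
  | succ m ih =>
    rw [qAd, ih, Finset.mul_sum, Finset.sum_mul, Finset.smul_sum,
      Finset.sum_range_succ' _ (m + 1)]
    have hleft : ∑ s ∈ Finset.range (m + 1), e *
          (((-1) ^ s * q ^ ((s : ℤ) * (a + m - 1)) * qBinom q m s) • (e ^ (m - s) * y * e ^ s))
        = ∑ s ∈ Finset.range (m + 1), ((-1) ^ (s + 1) * q ^ (((s : ℤ) + 1) * (a + m - 1))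
            * qBinom q m (s + 1)) • (e ^ (m + 1 - (s + 1)) * y * e ^ (s + 1))
          + e ^ (m + 1) * y := by
      -- The shifted sum has one extra term, `s = m`, where the truncated exponents disagree; its
      -- coefficient `[m choose m+1]` is zero.
      rw [Finset.sum_range_succ', Finset.sum_range_succ (n := m), qBinom_natCast_self_succ]
      simp only [mul_zero, zero_smul, add_zero]
      congr 1
      · refine Finset.sum_congr rfl fun s hs => ?_
        have hs' : m + 1 - (s + 1) = m - (s + 1) + 1 := by
          have := Finset.mem_range.1 hs; omega
        rw [mul_smul_comm, hs', pow_succ' e (m - (s + 1))]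
        push_cast
        simp only [mul_assoc]
      · simp [qBinom_zero, pow_succ', mul_assoc]
    rw [hleft, add_sub_right_comm, ← Finset.sum_sub_distrib]
    congr 1
    · refine Finset.sum_congr rfl fun s _ => ?_
      have h0 : m + 1 - (s + 1) = m - s := by omega
      rw [h0, smul_mul_assoc, smul_smul, mul_assoc (e ^ (m - s) * y), ← pow_succ, ← sub_smul]
      congr 1
      push_cast
      rw [qBinom_pascal hq hroot]
      have e1 : q ^ (((s : ℤ) + 1) * (a + m - 1))
          = q ^ (((s : ℤ) + 1) * (a + (m + 1) - 1)) * q ^ (-((s : ℤ) + 1)) := by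
        rw [← zpow_add₀ hq]; congr 1; ring
      have e2 : q ^ (a + 2 * (m : ℤ)) * q ^ ((s : ℤ) * (a + m - 1))
          = q ^ (((s : ℤ) + 1) * (a + (m + 1) - 1)) * q ^ ((m : ℤ) - s) := by
        rw [← zpow_add₀ hq, ← zpow_add₀ hq]; congr 1; ring
      rw [e1]
      linear_combination (-(-1) ^ s * qBinom q m s) * e2
    · simp [qBinom_zero]

/-- The quantum Serre relation for a nilpotent `e` and a vector `y` of weight `-n` that commutes
with the lowering operator `f`. -/
theorem serre_of_isNilpotent {q : RatFunc ℚ} (hq : q ≠ 0) (hroot : ∀ n : ℤ, n ≠ 0 → q ^ n ≠ 1)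
    {n : ℕ} {e f y K L : A} (hKL : K * L = 1) (hLK : L * K = 1)
    (hKe : K * e = q ^ (2 : ℤ) • (e * K)) (hKy : K * y = q ^ (-(n : ℤ)) • (y * K))
    (hef : e * f - f * e = (q - q⁻¹)⁻¹ • (K - L)) (hfy : f * y = y * f) (he : IsNilpotent e) :
    ∑ s ∈ Finset.range (n + 1 + 1),
      ((-1) ^ s * qBinom q ((n : ℤ) + 1) s) • (e ^ (n + 1 - s) * y * e ^ s) = 0 := by
  obtain ⟨N, hN⟩ := he
  have h := qAd_eq_zero hq hroot hKL hLK hKe hKy hef hfy (M := N + N) fun m hm => by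
    rw [qAd_eq_sum hq hroot]
    refine Finset.sum_eq_zero fun s _ => ?_
    -- For `m ≥ 2N`, one of the exponents `s` and `m - s` is at least `N`.
    rcases le_total N s with hs | hs
    · rw [pow_eq_zero_of_le hs hN, mul_zero, smul_zero]
    · rw [pow_eq_zero_of_le (by omega : N ≤ m - s) hN, zero_mul, zero_mul, smul_zero]
  rw [qAd_eq_sum hq hroot] at h
  rw [← h]
  refine Finset.sum_congr rfl fun s _ => ?_
  push_cast
  -- At weight `-n` and `m = n + 1` the powers of `q` in the expansion are trivial.
  rw [show -(n : ℤ) + (n + 1) - 1 = 0 by ring]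
  simp

end Expansion

/-! ### `v_i` is not a root of unity. -/

theorem CartanDatum.d_pos {I : Type*} [Fintype I] (C : CartanDatum I) (i : I) : 0 < C.d i := by
  have h1 := C.pos_diag i
  obtain ⟨m, hm⟩ := C.even_diag i
  unfold CartanDatum.d
  omega

theorem CartanDatum.v_ne_zero {I : Type*} [Fintype I] (C : CartanDatum I) (i : I) : C.v i ≠ 0 :=
  zpow_ne_zero _ RatFunc.X_ne_zero

theorem ratFunc_X_pow_ne_one {n : ℕ} (hn : n ≠ 0) : (RatFunc.X : RatFunc ℚ) ^ n ≠ 1 := by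
  intro h
  have h' : algebraMap (Polynomial ℚ) (RatFunc ℚ) (Polynomial.X ^ n)
      = algebraMap (Polynomial ℚ) (RatFunc ℚ) 1 := by simpa using h
  have h2 := congrArg Polynomial.natDegree (RatFunc.algebraMap_injective ℚ h')
  simp at h2
  exact hn h2

theorem ratFunc_X_zpow_ne_one {n : ℤ} (hn : n ≠ 0) : (RatFunc.X : RatFunc ℚ) ^ n ≠ 1 := by
  obtain ⟨m, rfl | rfl⟩ := n.eq_nat_or_neg
  · simpa using ratFunc_X_pow_ne_one (by simpa using hn)
  · simpa using ratFunc_X_pow_ne_one (by simpa using hn)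

theorem CartanDatum.v_zpow_ne_one {I : Type*} [Fintype I] (C : CartanDatum I) (i : I) (n : ℤ)
    (hn : n ≠ 0) : C.v i ^ n ≠ 1 := by
  rw [CartanDatum.v, ← zpow_mul]
  exact ratFunc_X_zpow_ne_one (mul_ne_zero (C.d_pos i).ne' hn)

/-! ### Weight idempotents, nilpotency and the quantum `sl₂`-triples in the algebra. -/

namespace RootDatum

variable {I : Type*} [Fintype I] {C : CartanDatum I} {X Y : Type*}
  [AddCommGroup X] [Module.Free ℤ X] [Module.Finite ℤ X]
  [AddCommGroup Y] [Module.Free ℤ Y] [Module.Finite ℤ Y]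

theorem exists_a_eq_neg (D : RootDatum C X Y) {i j : I} (hij : i ≠ j) :
    ∃ n : ℕ, D.a i j = -(n : ℤ) := by
  obtain ⟨n, hn⟩ := C.off_diag i j hij
  exact ⟨n, mul_right_cancel₀ (C.pos_diag i).ne' ((D.pairing_coroot_root i j).trans hn)⟩

/-- The idempotent `1_x` of the generalized `q`-Schur algebra. -/
noncomputable def idem (D : RootDatum C X Y) (S : Finset X) (x : X) : SchurAlg D S :=
  RingQuot.mkAlgHom (RatFunc ℚ) (Rel D S) (D.freeIdem S x)

variable (D : RootDatum C X Y) (S : Finset X)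

theorem idem_of_notMem {x : X} (hx : x ∉ D.weights S) : D.idem S x = 0 := by
  simp [idem, freeIdem, hx]

theorem idem_mul_self (x : X) : D.idem S x * D.idem S x = D.idem S x := by
  by_cases hx : x ∈ D.weights S
  · simpa [idem] using RingQuot.mkAlgHom_rel (RatFunc ℚ) (Rel.idem_mul_self (S := S) x hx)
  · simp [idem_of_notMem D S hx]

theorem idem_mul_of_ne {x y : X} (hxy : x ≠ y) : D.idem S x * D.idem S y = 0 := by
  by_cases hx : x ∈ D.weights S
  · by_cases hy : y ∈ D.weights S
    · simpa [idem] using RingQuot.mkAlgHom_rel (RatFunc ℚ) (Rel.idem_mul_of_ne (S := S) x y hx hy hxy)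
    · simp [idem_of_notMem D S hy]
  · simp [idem_of_notMem D S hx]

theorem E_mul_idem {x : X} (hx : x ∈ D.weights S) (i : I) :
    D.E S i * D.idem S x = D.idem S (x + D.root i) * D.E S i := by
  simpa [idem, E] using RingQuot.mkAlgHom_rel (RatFunc ℚ) (Rel.E_idem (S := S) i x hx)

theorem F_mul_idem {x : X} (hx : x ∈ D.weights S) (i : I) :
    D.F S i * D.idem S x = D.idem S (x - D.root i) * D.F S i := by
  simpa [idem, F] using RingQuot.mkAlgHom_rel (RatFunc ℚ) (Rel.F_idem (S := S) i x hx)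

theorem E_mul_F_of_ne {i j : I} (hij : i ≠ j) : D.E S i * D.F S j = D.F S j * D.E S i := by
  simpa [E, F, sub_eq_zero] using RingQuot.mkAlgHom_rel (RatFunc ℚ) (Rel.EF_of_ne (S := S) i j hij)

/-- The finite set `Wπ`. -/
noncomputable def weightFinset : Finset X := (D.finite_weights S).toFinset

theorem mem_weightFinset {x : X} : x ∈ D.weightFinset S ↔ x ∈ D.weights S := by
  simp [weightFinset]

theorem mkAlgHom_finsum (c : X → RatFunc ℚ) :
    RingQuot.mkAlgHom (RatFunc ℚ) (Rel D S)
        (∑ᶠ x : D.weights S, c (x : X) • D.freeIdem S (x : X))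
      = ∑ x ∈ D.weightFinset S, c x • D.idem S x := by
  rw [finsum_set_coe_eq_finsum_mem (f := fun x => c x • D.freeIdem S x),
    finsum_mem_eq_finite_toFinset_sum _ (D.finite_weights S), map_sum]
  simp [idem, weightFinset]

theorem sum_idem : ∑ x ∈ D.weightFinset S, D.idem S x = 1 := by
  have h := RingQuot.mkAlgHom_rel (RatFunc ℚ) (Rel.sum_idem (D := D) (S := S))
  have h' := mkAlgHom_finsum D S fun _ => 1
  simp only [one_smul] at h'
  rw [← h', h, map_one]

/-- The diagonal element `∑ c(x) 1_x`. -/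
noncomputable def diag (c : X → RatFunc ℚ) : SchurAlg D S :=
  ∑ x ∈ D.weightFinset S, c x • D.idem S x

theorem diag_mul_idem (c : X → RatFunc ℚ) (x : X) :
    D.diag S c * D.idem S x = c x • D.idem S x := by
  rw [diag, Finset.sum_mul, Finset.sum_eq_single x]
  · rw [smul_mul_assoc, idem_mul_self]
  · intro y _ hy
    rw [smul_mul_assoc, idem_mul_of_ne D S hy, smul_zero]
  · intro hx
    rw [idem_of_notMem D S (fun h => hx ((mem_weightFinset D S).2 h)), mul_zero]

/-- The `1_x` sum to `1`. Testing only on `x ∈ Wπ` matters, since the relations (c) are given only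
there. -/
theorem ext_idem {y z : SchurAlg D S}
    (h : ∀ x ∈ D.weights S, y * D.idem S x = z * D.idem S x) : y = z := by
  rw [← mul_one y, ← mul_one z, ← sum_idem D S, Finset.mul_sum, Finset.mul_sum]
  exact Finset.sum_congr rfl fun x hx => h x ((mem_weightFinset D S).1 hx)

theorem diag_mul_diag_eq_one {c c' : X → RatFunc ℚ} (h : ∀ x, c x * c' x = 1) :
    D.diag S c * D.diag S c' = 1 := by
  refine ext_idem D S fun x _ => ?_
  rw [mul_assoc, diag_mul_idem, mul_smul_comm, diag_mul_idem, smul_smul, mul_comm, h, one_smul,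
    one_mul]

theorem diag_mul_of_shift {z : SchurAlg D S} {r : X}
    (hz : ∀ x ∈ D.weights S, z * D.idem S x = D.idem S (x + r) * z) {c : X → RatFunc ℚ}
    {b : RatFunc ℚ} (hc : ∀ x, c (x + r) = b * c x) : D.diag S c * z = b • (z * D.diag S c) := by
  refine ext_idem D S fun x hx => ?_
  rw [mul_assoc, hz x hx, ← mul_assoc, diag_mul_idem, smul_mul_assoc, ← hz x hx, smul_mul_assoc,
    mul_assoc, diag_mul_idem, mul_smul_comm, smul_smul, hc]

/-- As `z` moves `1_x` to `1_{x+r}`, the first `x + m r` outside `Wπ` has idempotent `0`, which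
kills `z^m 1_x` and all higher powers. -/
theorem pow_mul_idem_of_shift {z : SchurAlg D S} {r : X}
    (hz : ∀ x ∈ D.weights S, z * D.idem S x = D.idem S (x + r) * z) {x : X}
    (n : ℕ) (hn : z ^ n * D.idem S x ≠ 0) : ∀ m ≤ n, x + m • r ∈ D.weights S := by
  have key : ∀ n, (∀ m < n, x + m • r ∈ D.weights S) →
      z ^ n * D.idem S x = D.idem S (x + n • r) * z ^ n := by
    intro n
    induction n with
    | zero => intro _; simp
    | succ n ih =>
      intro h
      rw [pow_succ', mul_assoc, ih fun m hm => h m (by omega), ← mul_assoc, hz _ (h n (by omega)),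
        mul_assoc, add_assoc, ← succ_nsmul]
  intro m
  induction m using Nat.strong_induction_on with
  | _ m ih =>
    intro hm
    by_contra hx
    apply hn
    have h := key m fun l hl => ih l hl (by omega)
    rw [idem_of_notMem D S hx, zero_mul] at h
    rw [← Nat.sub_add_cancel hm, pow_add, mul_assoc, h, mul_zero]

/-- With `N = |Wπ|`, a nonzero `z^N 1_x` would put the `N + 1` weights `x, x + r, …, x + N r` in
`Wπ`; they are distinct because `X` is torsion-free. -/
theorem isNilpotent_of_shift {z : SchurAlg D S} {r : X} (hr : r ≠ 0)
    (hz : ∀ x ∈ D.weights S, z * D.idem S x = D.idem S (x + r) * z) : IsNilpotent z := by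
  refine ⟨(D.weightFinset S).card, ext_idem D S fun x _ => ?_⟩
  rw [zero_mul]
  by_contra hne
  have h := pow_mul_idem_of_shift D S hz _ hne
  have : Module.IsTorsionFree ℤ X := inferInstance
  have hinj : Function.Injective fun m : ℕ => x + m • r := by
    intro m n hmn
    have h1 : ((m : ℤ) - n) • r = 0 := by
      have : m • r = n • r := add_left_cancel hmn
      rw [sub_smul, natCast_zsmul, natCast_zsmul, this, sub_self]
    have := (smul_eq_zero.1 h1).resolve_right hr
    omega
  have hcard := Finset.card_le_card_of_injOn (s := Finset.range ((D.weightFinset S).card + 1))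
    (t := D.weightFinset S) (fun m : ℕ => x + m • r)
    (fun m hm => (mem_weightFinset D S).2 (h m (by simpa [Nat.lt_succ_iff] using hm))) hinj.injOn
  simp at hcard

theorem root_ne_zero (i : I) : D.root i ≠ 0 := by
  intro h
  have := D.pairing_self i
  simp [h] at this

/-- The element `K_i^{ε} = ∑ v_i^{ε ⟨α_i^∨, x⟩} 1_x`. -/
noncomputable def K (i : I) (ε : ℤ) : SchurAlg D S :=
  D.diag S fun x => C.v i ^ (ε * D.pairing (D.coroot i) x)

theorem K_mul_K_neg (i : I) (ε : ℤ) : D.K S i ε * D.K S i (-ε) = 1 :=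
  diag_mul_diag_eq_one D S fun x => by
    rw [← zpow_add₀ (C.v_ne_zero i)]
    simp

theorem K_mul_E (i j : I) (ε : ℤ) :
    D.K S i ε * D.E S j = C.v i ^ (ε * D.a i j) • (D.E S j * D.K S i ε) :=
  diag_mul_of_shift D S (fun x hx => E_mul_idem D S hx j) fun x => by
    rw [← zpow_add₀ (C.v_ne_zero i), map_add, mul_add, add_comm, a]

theorem F_mul_idem' {x : X} (hx : x ∈ D.weights S) (i : I) :
    D.F S i * D.idem S x = D.idem S (x + -D.root i) * D.F S i := by
  rw [← sub_eq_add_neg, F_mul_idem D S hx]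

theorem K_mul_F (i j : I) (ε : ℤ) :
    D.K S i ε * D.F S j = C.v i ^ (-ε * D.a i j) • (D.F S j * D.K S i ε) :=
  diag_mul_of_shift D S (fun x hx => F_mul_idem' D S hx j) fun x => by
    rw [← zpow_add₀ (C.v_ne_zero i), map_add, map_neg, mul_add, add_comm, a, mul_neg, neg_mul]

theorem E_mul_F_self (i : I) : D.E S i * D.F S i - D.F S i * D.E S i
    = (C.v i - (C.v i)⁻¹)⁻¹ • (D.K S i 1 - D.K S i (-1)) := by
  have h := RingQuot.mkAlgHom_rel (RatFunc ℚ) (Rel.EF_self (D := D) (S := S) i)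
  rw [mkAlgHom_finsum D S fun x => qInt (C.v i) (D.pairing (D.coroot i) x)] at h
  simp only [map_sub, map_mul] at h
  refine Eq.trans h ?_
  rw [K, K, diag, diag, ← Finset.sum_sub_distrib, Finset.smul_sum]
  refine Finset.sum_congr rfl fun x _ => ?_
  rw [one_mul, neg_one_mul]
  exact qInt_smul (A := SchurAlg D S) _ _ _

end RootDatum

end QSchur

theorem theorem5 {I : Type*} [Fintype I] {C : QSchur.CartanDatum I} {X Y : Type*}
    [AddCommGroup X] [Module.Free ℤ X] [Module.Finite ℤ X]
    [AddCommGroup Y] [Module.Free ℤ Y] [Module.Finite ℤ Y]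
    (D : QSchur.RootDatum C X Y) (hrank : 2 ≤ Fintype.card I)
    (π : Finset X) (hπ : D.IsSaturated (π : Set X)) (i j : I) (hij : i ≠ j) :
    (∑ s ∈ Finset.range ((1 - D.a i j).toNat + 1),
        ((-1) ^ s * QSchur.qBinom (C.v i) (1 - D.a i j) s) •
          (D.E π i ^ ((1 - D.a i j).toNat - s) * D.E π j * D.E π i ^ s) = 0) ∧
    (∑ s ∈ Finset.range ((1 - D.a i j).toNat + 1),
        ((-1) ^ s * QSchur.qBinom (C.v i) (1 - D.a i j) s) •
          (D.F π i ^ ((1 - D.a i j).toNat - s) * D.F π j * D.F π i ^ s) = 0) := by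

  obtain ⟨n, hn⟩ := D.exists_a_eq_neg hij
  have hv := C.v_ne_zero i
  have hroot := C.v_zpow_ne_one i
  have hai : D.a i i = 2 := D.pairing_self i
  have hKL := D.K_mul_K_neg π i 1
  have hLK : D.K π i (-1) * D.K π i 1 = 1 := D.K_mul_K_neg π i (-1)
  have hnat : ((1 : ℤ) - -(n : ℤ)).toNat = n + 1 := by omega
  have hint : (1 : ℤ) - -(n : ℤ) = (n : ℤ) + 1 := by ring
  rw [hn, hnat, hint]
  constructor
  · refine QSchur.serre_of_isNilpotent hv hroot hKL hLK ?_ ?_ (D.E_mul_F_self π i)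
      (D.E_mul_F_of_ne π hij.symm).symm
      (D.isNilpotent_of_shift π (D.root_ne_zero i) fun x hx => D.E_mul_idem π hx i)
    · rw [D.K_mul_E, hai, one_mul]
    · rw [D.K_mul_E, hn, one_mul]
  -- Now `e = F_i`, `f = E_i`, and `K_i⁻¹` plays the role of `K`, so that `F_i` has weight `2` and
  -- `F_j` weight `-n`.
  · refine QSchur.serre_of_isNilpotent hv hroot hLK hKL ?_ ?_ ?_ (D.E_mul_F_of_ne π hij)
      (D.isNilpotent_of_shift π (neg_ne_zero.2 (D.root_ne_zero i)) fun x hx => D.F_mul_idem' π hx i)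
    · rw [D.K_mul_F, hai, neg_neg, one_mul]
    · rw [D.K_mul_F, hn, neg_neg, one_mul]
    · rw [← neg_sub, D.E_mul_F_self, ← neg_sub (D.K π i 1)]
      exact (smul_neg (C.v i - (C.v i)⁻¹)⁻¹ (D.K π i 1 - D.K π i (-1))).symm
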